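/- Let $1\le k\le n$ and let $NC_n$ be the set of noncrossing partitions of $\{1,\dots,n\}$ (set partitions with no $i<j<k'<\ell$ such that $i,k'$ lie in one block and $j,\ell$ in another), ordered by refinement, with top element $\hat 1$ the one-block partition; write $\lessdot$ for the covering relation. For $\rho,\pi\in NC_n$ write $\rho\sqsubset\pi$ if $\rho$ is obtained from $\pi$ by splitting one block $B$ of $\pi$ into at least two blocks, each of which is an interval of $B$, i.e. of the form $\{t\in B: a\le t\le b\}$ with $a,b\in B$. A *final chain of length $k$* in $NC_n$ is a $k$-tuple $\Pi=(\pi_{n-k},\dots,\pi_{n-1})$ of elements of $NC_n$ with $\pi_{n-k}\lessdot\cdots\lessdot\pi_{n-1}=\hat 1$. With indeterminates $X_i$, its weight is \[ \mathrm{wt}(\Pi)=\prod_{\substack{n-k\le i\le n-2\\ \pi_i\not\sqsubset\pi_{i+1}}}X_i . \] Then \[ \sum_{\Pi}\mathrm{wt}(\Pi)=\frac1n\binom nk\prod_{i=n-k}^{n-2}\bigl(iX_i+(n-i)\bigr), \] where the sum is over all final chains of length $k$ in $NC_n$. In particular, the number of final chains of length $k$ in $NC_n$ is $n^{k-2}\binom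 nk$. -/

import Mathlib

/-- A set partition of a finite totally ordered set is noncrossing if there are no `i < j < k < l`
with `i, k` in one block and `j, l` in another one. -/
def IsNoncrossing {α : Type*} [LinearOrder α] [Fintype α]
    (π : Finpartition (Finset.univ : Finset α)) : Prop :=
  ¬ ∃ i j k l : α, i < j ∧ j < k ∧ k < l ∧
    ∃ B ∈ π.parts, ∃ C ∈ π.parts, B ≠ C ∧ i ∈ B ∧ k ∈ B ∧ j ∈ C ∧ l ∈ C

/-- The noncrossing partitions of an `n`-element chain, with the refinement order (the order of
`Finpartition`: every block of the smaller partition lies in a block of the larger one). -/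
abbrev NC (n : ℕ) : Type :=
  {π : Finpartition (Finset.univ : Finset (Fin n)) // IsNoncrossing π}

/-- A partition of `B` all of whose blocks are intervals of `B`. -/
def IsIntervalPartition {α : Type*} [LinearOrder α] {B : Finset α} (Q : Finpartition B) : Prop :=
  ∀ C ∈ Q.parts, ∃ a ∈ B, ∃ b ∈ B, C = {t ∈ B | a ≤ t ∧ t ≤ b}

/-- The relation `ρ ⊏ π`: `ρ` is obtained from `π` by splitting one block `B` of `π` into at least
two blocks which form an interval partition of `B`. -/
def IntervalSplit {n : ℕ} (ρ π : NC n) : Prop :=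
  ∃ B ∈ π.1.parts, ∃ Q : Finpartition B,
    2 ≤ Q.parts.card ∧ IsIntervalPartition Q ∧ ρ.1.parts = π.1.parts.erase B ∪ Q.parts

/-- Final chains of length `k` in `NC n`: `k`-tuples `c 0 ⋖ c 1 ⋖ ⋯ ⋖ c (k - 1)` of successive
covers in `NC n` whose last entry is the one-block partition. The entry `c j` is the element usually
written `π_{n - k + j}`. -/
def FinalChain (n k : ℕ) : Type :=
  {c : Fin k → NC n //
    (∀ j : Fin (k - 1), c ⟨j, by omega⟩ ⋖ c ⟨j + 1, by omega⟩) ∧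
    ∀ j : Fin k, (j : ℕ) + 1 = k → (c j).1 = ⊤}

noncomputable instance (n k : ℕ) : Fintype (FinalChain n k) :=
  haveI : Finite (FinalChain n k) := Subtype.finite
  Fintype.ofFinite _

open Classical in
/-- The weight of a final chain: the product of the variables `X_i`, `n - k ≤ i ≤ n - 2`, over the
steps `π_i ⋖ π_{i+1}` for which `π_i ⊏ π_{i+1}` does not hold (`i = n - k + j`). -/
noncomputable def FinalChain.weight {n k : ℕ} (c : FinalChain n k) : MvPolynomial ℕ ℚ :=
  ∏ j : Fin (k - 1),
    if IntervalSplit (c.1 ⟨j, by omega⟩) (c.1 ⟨j + 1, by omega⟩) then 1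
    else MvPolynomial.X (n - k + j)

/-! Weight the bottom element of a chain additionally by `∏ y_{|B|}` over its blocks `B`, and put `Y
= ∑_{m ≥ 1} y_m z^m`. For chains of length `k`, the sum times `k` is then `∏ (i x_i + (n - i)) ·
[z^n] Y^k` (`FinalChain.sum_weightAt_mul_prod`), by induction on `k`.

A cover `ρ ⋖ π` cuts one block `B` into an interval `C` of `B` avoiding `min B` and its complement,
in a unique way (`NC.exists_eq_splitInterval`, `NC.splitInterval_inj`); `ρ ⊏ π` holds exactly when
`C` reaches `max B`. A block of size `m` has `m - c` such intervals of size `c`, one of them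
reaching the maximum. So lengthening a chain replaces one factor `y_m` by `[z^m] S`, where `S = Y
((1 - x) Y + x z Y')`, and sums over the blocks. This is a derivation: put `y_m + t [z^m] S` into
the induction hypothesis and differentiate at `t = 0`. It turns `Y^k` into `k Y^(k-1) S`, and since
`(k + 1) Y^k Y' = (Y^(k+1))'`, the coefficient of `z^n` is again that of `Y^(k+1)` up to the new
factor (`coeff_pow_mul_splitSeries`).

Setting all `y_m = 1` gives the formula; setting also `x_i = 1` makes every factor `n` and counts
the chains. -/

theorem isNoncrossing_iff {α : Type*} [LinearOrder α] [Fintype α]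
    (π : Finpartition (Finset.univ : Finset α)) :
    IsNoncrossing π ↔ ∀ i j k l : α, i < j → j < k → k < l →
      ∀ B ∈ π.parts, ∀ C ∈ π.parts, i ∈ B → k ∈ B → j ∈ C → l ∈ C → B = C := by
  unfold IsNoncrossing
  constructor
  · intro h i j k l h1 h2 h3 B hB C hC hi hk hj hl
    by_contra hne
    exact h ⟨i, j, k, l, h1, h2, h3, B, hB, C, hC, hne, hi, hk, hj, hl⟩
  · rintro h ⟨i, j, k, l, h1, h2, h3, B, hB, C, hC, hne, hi, hk, hj, hl⟩
    exact hne (h i j k l h1 h2 h3 B hB C hC hi hk hj hl)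

/-! ### Splitting a block of a set partition in two. -/

namespace Finpartition

variable {α : Type*} [DecidableEq α] {s : Finset α}

/-- The partition obtained from `π` by splitting the block `B` into `C` and `B \ C`. -/
def splitBlock (π : Finpartition s) (B C : Finset α) (hB : B ∈ π.parts) (hC : C.Nonempty)
    (hCB : C ⊂ B) : Finpartition s :=
  ofExistsUnique (π.parts.erase B ∪ {C, B \ C})
    (by
      intro p hp
      simp only [Finset.mem_union, Finset.mem_erase, Finset.mem_insert,
        Finset.mem_singleton] at hp
      have hBs : B ⊆ s := π.le hB
      rcases hp with hp | rfl | rfl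
      · exact π.le hp.2
      · exact hCB.1.trans hBs
      · exact Finset.sdiff_subset.trans hBs)
    (by
      intro t ht
      obtain ⟨D, ⟨hD, htD⟩, huniq⟩ := π.existsUnique_mem ht
      by_cases hDB : D = B
      · subst hDB
        by_cases htC : t ∈ C
        · refine ⟨C, by simp [htC], ?_⟩
          rintro E ⟨hE, htE⟩
          simp only [Finset.mem_union, Finset.mem_erase, Finset.mem_insert,
            Finset.mem_singleton] at hE
          rcases hE with hE | rfl | rfl
          · exact absurd (huniq E ⟨hE.2, htE⟩) hE.1
          · rfl
          · simp [htC] at htE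
        · refine ⟨D \ C, by simp [htC, htD], ?_⟩
          rintro E ⟨hE, htE⟩
          simp only [Finset.mem_union, Finset.mem_erase, Finset.mem_insert,
            Finset.mem_singleton] at hE
          rcases hE with hE | rfl | rfl
          · exact absurd (huniq E ⟨hE.2, htE⟩) hE.1
          · exact absurd htE htC
          · rfl
      · have htB : t ∉ B := fun h => hDB (huniq B ⟨hB, h⟩).symm
        refine ⟨D, by simp [hD, hDB, htD], ?_⟩
        rintro E ⟨hE, htE⟩
        simp only [Finset.mem_union, Finset.mem_erase, Finset.mem_insert,
          Finset.mem_singleton] at hE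
        rcases hE with hE | rfl | rfl
        · exact huniq E ⟨hE.2, htE⟩
        · exact absurd (hCB.1 htE) htB
        · exact absurd (Finset.sdiff_subset htE) htB)
    (by
      simp only [Finset.mem_union, Finset.mem_erase, Finset.mem_insert,
        Finset.mem_singleton, not_or]
      refine ⟨fun h => π.bot_notMem h.2, fun h => ?_, fun h => ?_⟩
      · simp [← h] at hC
      · exact hCB.2 (Finset.sdiff_eq_empty_iff_subset.1 h.symm))

variable (π : Finpartition s) {B C : Finset α} (hB : B ∈ π.parts) (hC : C.Nonempty) (hCB : C ⊂ B)

theorem splitBlock_parts :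
    (π.splitBlock B C hB hC hCB).parts = π.parts.erase B ∪ {C, B \ C} := rfl

theorem mem_splitBlock {D : Finset α} : D ∈ (π.splitBlock B C hB hC hCB).parts ↔
    (D ≠ B ∧ D ∈ π.parts) ∨ D = C ∨ D = B \ C := by
  simp only [splitBlock_parts, Finset.mem_union, Finset.mem_erase, Finset.mem_insert,
    Finset.mem_singleton]

theorem eq_of_subset_of_mem {π : Finpartition s} {D E : Finset α} (hD : D ∈ π.parts)
    (hE : E ∈ π.parts) (h : D ⊆ E) : D = E := by
  obtain ⟨t, ht⟩ := π.nonempty_of_mem_parts hD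
  exact π.eq_of_mem_parts hD hE ht (h ht)

theorem splitBlock_le : π.splitBlock B C hB hC hCB ≤ π := by
  intro D hD
  rw [mem_splitBlock] at hD
  rcases hD with hD | rfl | rfl
  · exact ⟨D, hD.2, le_rfl⟩
  · exact ⟨B, hB, hCB.1⟩
  · exact ⟨B, hB, Finset.sdiff_subset⟩

theorem notMem_parts_of_ssubset (π : Finpartition s) (hB : B ∈ π.parts) (hCB : C ⊂ B) :
    C ∉ π.parts := fun h => hCB.ne (eq_of_subset_of_mem h hB hCB.1)

theorem sdiff_ssubset_of_ssubset (hC : C.Nonempty) (hCB : C ⊂ B) : B \ C ⊂ B :=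
  Finset.sdiff_ssubset hCB.1 hC

theorem sdiff_notMem_parts (π : Finpartition s) (hB : B ∈ π.parts) (hC : C.Nonempty)
    (hCB : C ⊂ B) : B \ C ∉ π.parts :=
  notMem_parts_of_ssubset π hB (sdiff_ssubset_of_ssubset hC hCB)

theorem notMem_splitBlock : B ∉ (π.splitBlock B C hB hC hCB).parts := by
  rw [mem_splitBlock]
  rintro (h | h | h)
  · exact h.1 rfl
  · exact hCB.ne h.symm
  · exact (sdiff_ssubset_of_ssubset hC hCB).ne h.symm

theorem splitBlock_lt : π.splitBlock B C hB hC hCB < π := by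
  refine lt_of_le_of_ne (splitBlock_le π hB hC hCB) fun h => ?_
  apply notMem_splitBlock π hB hC hCB
  rw [h]
  exact hB

/-- Nothing lies strictly between a partition and the result of splitting one of its blocks into
two. -/
theorem eq_of_splitBlock_le {σ : Finpartition s} (h1 : π.splitBlock B C hB hC hCB ≤ σ)
    (h2 : σ ≤ π) : σ ≤ π.splitBlock B C hB hC hCB ∨ π ≤ σ := by
  obtain ⟨S, hS, hCS⟩ := h1 ((mem_splitBlock π hB hC hCB).2 (Or.inr (Or.inl rfl)))
  obtain ⟨S', hS', hCS'⟩ := h1 ((mem_splitBlock π hB hC hCB).2 (Or.inr (Or.inr rfl)))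
  -- If one block of `σ` contains both pieces, then `π ≤ σ`; otherwise no block of `σ` meets both
  -- pieces.
  by_cases hSS : S = S'
  · right
    subst hSS
    intro D hD
    by_cases hDB : D = B
    · subst hDB
      refine ⟨S, hS, fun t ht => ?_⟩
      by_cases htC : t ∈ C
      · exact hCS htC
      · exact hCS' (Finset.mem_sdiff.2 ⟨ht, htC⟩)
    · exact h1 ((mem_splitBlock π hB hC hCB).2 (Or.inl ⟨hDB, hD⟩))
  · left
    intro T hT
    obtain ⟨D, hD, hTD⟩ := h2 hT
    by_cases hDB : D = B
    · subst hDB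
      obtain ⟨t, ht⟩ := σ.nonempty_of_mem_parts hT
      by_cases htC : t ∈ C
      · refine ⟨C, (mem_splitBlock π hB hC hCB).2 (Or.inr (Or.inl rfl)), fun u hu => ?_⟩
        by_contra huC
        exact hSS ((σ.eq_of_mem_parts hS hT (hCS htC) ht).trans
          (σ.eq_of_mem_parts hT hS' hu (hCS' (Finset.mem_sdiff.2 ⟨hTD hu, huC⟩))))
      · refine ⟨D \ C, (mem_splitBlock π hB hC hCB).2 (Or.inr (Or.inr rfl)), fun u hu => ?_⟩
        refine Finset.mem_sdiff.2 ⟨hTD hu, fun huC => hSS ?_⟩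
        exact (σ.eq_of_mem_parts hS hT (hCS huC) hu).trans
          (σ.eq_of_mem_parts hT hS' ht (hCS' (Finset.mem_sdiff.2 ⟨hTD ht, htC⟩)))
    · exact ⟨D, (mem_splitBlock π hB hC hCB).2 (Or.inl ⟨hDB, hD⟩), hTD⟩

theorem prod_splitBlock {R : Type*} [CommMonoid R] (y : Finset α → R) :
    ∏ D ∈ (π.splitBlock B C hB hC hCB).parts, y D =
      (∏ D ∈ π.parts.erase B, y D) * (y C * y (B \ C)) := by
  have hne : C ≠ B \ C := by
    obtain ⟨t, ht⟩ := hC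
    intro h
    have h' := ht
    rw [h] at h'
    exact (Finset.mem_sdiff.1 h').2 ht
  rw [splitBlock_parts, Finset.prod_union, Finset.prod_pair hne]
  rw [Finset.disjoint_left]
  intro D hD hD'
  simp only [Finset.mem_insert, Finset.mem_singleton] at hD'
  rcases hD' with rfl | rfl
  · exact notMem_parts_of_ssubset π hB hCB (Finset.mem_of_mem_erase hD)
  · exact sdiff_notMem_parts π hB hC hCB (Finset.mem_of_mem_erase hD)

end Finpartition

/-! ### Intervals of a block that avoid its minimum. -/

section BlockIntervals

variable {α : Type*} [LinearOrder α]

/-- The elements of `B` between `a` and `b`. -/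
def blockInterval (B : Finset α) (a b : α) : Finset α := {t ∈ B | a ≤ t ∧ t ≤ b}

theorem mem_blockInterval {B : Finset α} {a b t : α} :
    t ∈ blockInterval B a b ↔ t ∈ B ∧ a ≤ t ∧ t ≤ b := by
  simp [blockInterval]

/-- The endpoints `(a, b)` of the nonempty intervals of `B` that avoid the minimum of `B`. -/
def intervalEnds (B : Finset α) : Finset (α × α) :=
  {p ∈ B ×ˢ B | p.1 ≤ p.2 ∧ ∃ z ∈ B, z < p.1}

theorem mem_intervalEnds {B : Finset α} {p : α × α} :
    p ∈ intervalEnds B ↔ (p.1 ∈ B ∧ p.2 ∈ B) ∧ p.1 ≤ p.2 ∧ ∃ z ∈ B, z < p.1 := by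
  simp [intervalEnds]

theorem blockInterval_nonempty {B : Finset α} {p : α × α} (h : p ∈ intervalEnds B) :
    (blockInterval B p.1 p.2).Nonempty := by
  rw [mem_intervalEnds] at h
  exact ⟨p.1, mem_blockInterval.2 ⟨h.1.1, le_rfl, h.2.1⟩⟩

theorem blockInterval_ssubset {B : Finset α} {p : α × α} (h : p ∈ intervalEnds B) :
    blockInterval B p.1 p.2 ⊂ B := by
  rw [mem_intervalEnds] at h
  obtain ⟨z, hz, hza⟩ := h.2.2
  refine ⟨Finset.filter_subset _ _, fun hsub => ?_⟩
  exact (mem_blockInterval.1 (hsub hz)).2.1.not_gt hza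

theorem eq_of_blockInterval_eq {B : Finset α} {p q : α × α} (hp : p ∈ intervalEnds B)
    (hq : q ∈ intervalEnds B) (h : blockInterval B p.1 p.2 = blockInterval B q.1 q.2) : p = q := by
  rw [mem_intervalEnds] at hp hq
  have h1 : p.1 ∈ blockInterval B q.1 q.2 := h ▸ mem_blockInterval.2 ⟨hp.1.1, le_rfl, hp.2.1⟩
  have h2 : p.2 ∈ blockInterval B q.1 q.2 := h ▸ mem_blockInterval.2 ⟨hp.1.2, hp.2.1, le_rfl⟩
  have h3 : q.1 ∈ blockInterval B p.1 p.2 := h ▸ mem_blockInterval.2 ⟨hq.1.1, le_rfl, hq.2.1⟩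
  have h4 : q.2 ∈ blockInterval B p.1 p.2 := h ▸ mem_blockInterval.2 ⟨hq.1.2, hq.2.1, le_rfl⟩
  rw [mem_blockInterval] at h1 h2 h3 h4
  exact Prod.ext (le_antisymm h3.2.1 h1.2.1) (le_antisymm h2.2.2 h4.2.2)

/-- Only the right side contains `min B`, so the pair of pieces determines which one is the
interval. -/
theorem blockInterval_ne_sdiff {B : Finset α} {p q : α × α} (hp : p ∈ intervalEnds B)
    (hq : q ∈ intervalEnds B) : blockInterval B p.1 p.2 ≠ B \ blockInterval B q.1 q.2 := by
  intro h
  rw [mem_intervalEnds] at hp hq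
  obtain ⟨z, hz, hzp⟩ := hp.2.2
  obtain ⟨w, hw, hwq⟩ := hq.2.2
  have hz' : z ∈ blockInterval B q.1 q.2 := by
    by_contra hzn
    have := h ▸ Finset.mem_sdiff.2 ⟨hz, hzn⟩
    exact (mem_blockInterval.1 this).2.1.not_gt hzp
  have hw' : w ∈ blockInterval B p.1 p.2 := by
    rw [h, Finset.mem_sdiff]
    exact ⟨hw, fun hws => (mem_blockInterval.1 hws).2.1.not_gt hwq⟩
  exact lt_irrefl _ (calc
    z < p.1 := hzp
    _ ≤ w := (mem_blockInterval.1 hw').2.1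
    _ < q.1 := hwq
    _ ≤ z := (mem_blockInterval.1 hz').2.1)

end BlockIntervals

/-! ### Covering relations in the noncrossing partition lattice. -/

section Covers

variable {n : ℕ}

/-- Splitting off an interval of a block of a noncrossing partition. -/
def NC.splitInterval (π : NC n) (B : Finset (Fin n)) (p : Fin n × Fin n) (hB : B ∈ π.1.parts)
    (hp : p ∈ intervalEnds B) : NC n :=
  ⟨π.1.splitBlock B (blockInterval B p.1 p.2) hB (blockInterval_nonempty hp)
    (blockInterval_ssubset hp), by
    have hπ := (isNoncrossing_iff _).1 π.2
    rw [isNoncrossing_iff]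
    intro i j k l hij hjk hkl D hD E hE hiD hkD hjE hlE
    obtain ⟨D', hD', hDD'⟩ := π.1.splitBlock_le hB (blockInterval_nonempty hp)
      (blockInterval_ssubset hp) hD
    obtain ⟨E', hE', hEE'⟩ := π.1.splitBlock_le hB (blockInterval_nonempty hp)
      (blockInterval_ssubset hp) hE
    have hDE := hπ i j k l hij hjk hkl D' hD' E' hE' (hDD' hiD) (hDD' hkD) (hEE' hjE) (hEE' hlE)
    subst hDE
    -- Both blocks lie in `D'`. If they were the two pieces of `B`, an element of the complement
    -- would lie between two elements of the interval.
    rw [Finpartition.mem_splitBlock] at hD hE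
    have key : ∀ F, F ≠ B ∧ F ∈ π.1.parts → F ⊆ D' → D' = F := fun F hF hFD =>
      (Finpartition.eq_of_subset_of_mem hF.2 hD' hFD).symm
    rcases hD with hD | hD | hD
    · have h1 := key D hD hDD'
      rcases hE with hE | hE | hE
      · exact h1.symm.trans (key E hE hEE')
      · subst hE h1
        exact absurd (π.1.eq_of_mem_parts hD' hB (hEE' hjE) (mem_blockInterval.1 hjE).1) hD.1
      · subst hE h1
        exact absurd (π.1.eq_of_mem_parts hD' hB (hEE' hjE) (Finset.mem_sdiff.1 hjE).1) hD.1
    · subst hD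
      rw [mem_blockInterval] at hiD hkD
      rcases hE with hE | hE | hE
      · have h1 := key E hE hEE'
        subst h1
        exact absurd (π.1.eq_of_mem_parts hD' hB (hDD' (mem_blockInterval.2 hiD)) hiD.1) hE.1
      · exact hE.symm
      · subst hE
        rw [Finset.mem_sdiff] at hjE
        exact absurd (mem_blockInterval.2 ⟨hjE.1, hiD.2.1.trans hij.le, hjk.le.trans hkD.2.2⟩) hjE.2
    · subst hD
      rcases hE with hE | hE | hE
      · have h1 := key E hE hEE'
        subst h1
        exact absurd (π.1.eq_of_mem_parts hD' hB (hDD' hiD) (Finset.mem_sdiff.1 hiD).1) hE.1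
      · subst hE
        rw [Finset.mem_sdiff] at hkD
        rw [mem_blockInterval] at hjE hlE
        exact absurd (mem_blockInterval.2 ⟨hkD.1, hjE.2.1.trans hjk.le, hkl.le.trans hlE.2.2⟩) hkD.2
      · exact hE.symm⟩

theorem NC.mem_splitInterval {π : NC n} {B : Finset (Fin n)} {p : Fin n × Fin n}
    (hB : B ∈ π.1.parts) (hp : p ∈ intervalEnds B) {D : Finset (Fin n)} :
    D ∈ (π.splitInterval B p hB hp).1.parts ↔
      (D ≠ B ∧ D ∈ π.1.parts) ∨ D = blockInterval B p.1 p.2 ∨ D = B \ blockInterval B p.1 p.2 :=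
  Finpartition.mem_splitBlock π.1 hB (blockInterval_nonempty hp) (blockInterval_ssubset hp)

theorem NC.splitInterval_covBy (π : NC n) (B : Finset (Fin n)) (p : Fin n × Fin n)
    (hB : B ∈ π.1.parts) (hp : p ∈ intervalEnds B) : π.splitInterval B p hB hp ⋖ π := by
  refine ⟨π.1.splitBlock_lt hB (blockInterval_nonempty hp) (blockInterval_ssubset hp),
    fun σ h1 h2 => ?_⟩
  rcases π.1.eq_of_splitBlock_le hB (blockInterval_nonempty hp) (blockInterval_ssubset hp)
    (σ := σ.1) h1.le h2.le with h | h
  · exact h1.not_ge h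
  · exact h2.not_ge h

/-- Below a noncrossing partition, every noncrossing partition is below one that arises from
splitting off an interval of a block. -/
theorem NC.exists_le_splitInterval {ρ π : NC n} (h : ρ < π) :
    ∃ B p, ∃ (hB : B ∈ π.1.parts) (hp : p ∈ intervalEnds B), ρ ≤ π.splitInterval B p hB hp := by
  have hρ := (isNoncrossing_iff _).1 ρ.2
  obtain ⟨B, hB, hBρ⟩ : ∃ B ∈ π.1.parts, B ∉ ρ.1.parts := by
    by_contra! hall
    exact h.not_ge fun B hB => ⟨B, hall B hB, le_rfl⟩
  have hBne := π.1.nonempty_of_mem_parts hB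
  obtain ⟨m, hmB, hmin⟩ : ∃ m ∈ B, ∀ t ∈ B, m ≤ t :=
    ⟨B.min' hBne, B.min'_mem hBne, fun t ht => B.min'_le t ht⟩
  obtain ⟨D, hD, hmD⟩ := ρ.1.exists_mem (Finset.mem_univ m)
  have hsub : ∀ E ∈ ρ.1.parts, ∀ t ∈ E, t ∈ B → E ⊆ B := by
    intro E hE t htE htB
    obtain ⟨F, hF, hEF⟩ := h.le hE
    rwa [π.1.eq_of_mem_parts hF hB (hEF htE) htB] at hEF
  have hDB : D ⊆ B := hsub D hD m hmD hmB
  have hne : (B \ D).Nonempty := by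
    rw [Finset.sdiff_nonempty]
    intro hBD
    exact hBρ (hDB.antisymm hBD ▸ hD)
  obtain ⟨a, haBD, hamin⟩ : ∃ a ∈ B \ D, ∀ t ∈ B \ D, a ≤ t :=
    ⟨(B \ D).min' hne, (B \ D).min'_mem hne, fun t ht => (B \ D).min'_le t ht⟩
  rw [Finset.mem_sdiff] at haBD
  have hma : m < a := lt_of_le_of_ne (hmin a haBD.1) (fun h => haBD.2 (h ▸ hmD))
  -- The interval to split off is the first gap of `D` in `B`: from `a` up to the next element of
  -- `D`, if any.
  set G : Finset (Fin n) := {t ∈ B | a ≤ t ∧ ∀ d ∈ D, a ≤ d → t < d} with hG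
  have haG : a ∈ G := by
    refine Finset.mem_filter.2 ⟨haBD.1, le_rfl, fun d hd had => ?_⟩
    exact lt_of_le_of_ne had fun h => haBD.2 (h ▸ hd)
  obtain ⟨b, hbG, hbmax⟩ : ∃ b ∈ G, ∀ t ∈ G, t ≤ b :=
    ⟨G.max' ⟨a, haG⟩, G.max'_mem _, fun t ht => G.le_max' t ht⟩
  have hbG' := (Finset.mem_filter.1 hbG).2
  have hseg : ∀ t, t ∈ blockInterval B a b ↔ t ∈ B ∧ a ≤ t ∧ ∀ d ∈ D, a ≤ d → t < d := by
    intro t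
    rw [mem_blockInterval]
    constructor
    · rintro ⟨htB, hat, htb⟩
      exact ⟨htB, hat, fun d hd had => htb.trans_lt (hbG'.2 d hd had)⟩
    · rintro ⟨htB, hat, ht⟩
      exact ⟨htB, hat, hbmax t (Finset.mem_filter.2 ⟨htB, hat, ht⟩)⟩
  have hp : (a, b) ∈ intervalEnds B :=
    mem_intervalEnds.2 ⟨⟨haBD.1, (Finset.mem_filter.1 hbG).1⟩, hbG'.1, m, hmB, hma⟩
  refine ⟨B, (a, b), hB, hp, fun E hE => ?_⟩
  obtain ⟨F, hF, hEF⟩ := h.le hE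
  by_cases hFB : F = B
  · subst hFB
    by_cases hEC : ∃ t ∈ E, t ∈ blockInterval F a b
    · obtain ⟨t, htE, htC⟩ := hEC
      refine ⟨blockInterval F a b, (NC.mem_splitInterval hB hp).2 (Or.inr (Or.inl rfl)),
        fun s hs => ?_⟩
      rw [hseg] at htC ⊢
      have hED : D ≠ E := by
        rintro rfl
        exact lt_irrefl _ (htC.2.2 t htE htC.2.1)
      have hsD : s ∉ D := fun hsD => hED (ρ.1.eq_of_mem_parts hD hE hsD hs)
      have has : a ≤ s := hamin s (Finset.mem_sdiff.2 ⟨hEF hs, hsD⟩)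
      refine ⟨hEF hs, has, fun d hd had => ?_⟩
      -- Otherwise `m < t < d < s` is a crossing of `D` and `E`.
      by_contra hds
      have hds' : d < s := lt_of_le_of_ne (not_lt.1 hds) fun h => hsD (h ▸ hd)
      exact hED (hρ m t d s (hma.trans_le htC.2.1) (htC.2.2 d hd had) hds' D hD E hE hmD hd
        htE hs)
    · push Not at hEC
      exact ⟨F \ blockInterval F a b, (NC.mem_splitInterval hB hp).2 (Or.inr (Or.inr rfl)),
        fun s hs => Finset.mem_sdiff.2 ⟨hEF hs, hEC s hs⟩⟩
  · exact ⟨F, (NC.mem_splitInterval hB hp).2 (Or.inl ⟨hFB, hF⟩), hEF⟩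

theorem NC.exists_eq_splitInterval {ρ π : NC n} (h : ρ ⋖ π) :
    ∃ B p, ∃ (hB : B ∈ π.1.parts) (hp : p ∈ intervalEnds B), π.splitInterval B p hB hp = ρ := by
  obtain ⟨B, p, hB, hp, hle⟩ := NC.exists_le_splitInterval h.lt
  refine ⟨B, p, hB, hp, ?_⟩
  by_contra hne
  exact h.2 (lt_of_le_of_ne hle (Ne.symm hne)) (π.splitInterval_covBy B p hB hp).lt

/-- `B` is the only block of `π` that is lost, and the interval is the new block that avoids `min
B`. -/
theorem NC.splitInterval_inj {π : NC n} {B B' : Finset (Fin n)} {p p' : Fin n × Fin n}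
    {hB : B ∈ π.1.parts} {hp : p ∈ intervalEnds B} {hB' : B' ∈ π.1.parts}
    {hp' : p' ∈ intervalEnds B'} (h : π.splitInterval B p hB hp = π.splitInterval B' p' hB' hp') :
    B = B' ∧ p = p' := by
  have hparts : ∀ D, D ∈ (π.splitInterval B p hB hp).1.parts ↔
      D ∈ (π.splitInterval B' p' hB' hp').1.parts := by rw [h]; exact fun _ => Iff.rfl
  simp only [NC.mem_splitInterval] at hparts
  have hBB : B = B' := by
    by_contra hne
    exact Finpartition.notMem_splitBlock π.1 hB (blockInterval_nonempty hp)
      (blockInterval_ssubset hp) ((NC.mem_splitInterval hB hp).2 ((hparts B).2 (Or.inl ⟨hne, hB⟩)))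
  subst hBB
  refine ⟨rfl, ?_⟩
  rcases (hparts (blockInterval B p.1 p.2)).1 (Or.inr (Or.inl rfl)) with h1 | h1 | h1
  · exact absurd h1.2 (Finpartition.notMem_parts_of_ssubset π.1 hB (blockInterval_ssubset hp))
  · exact eq_of_blockInterval_eq hp hp' h1
  · exact absurd h1 (blockInterval_ne_sdiff hp hp')

/-- The complement always has an element below the interval, so it is itself an interval of `B`
exactly when nothing of `B` lies above. -/
theorem intervalSplit_splitInterval_iff {π : NC n} {B : Finset (Fin n)} {p : Fin n × Fin n}
    (hB : B ∈ π.1.parts) (hp : p ∈ intervalEnds B) :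
    IntervalSplit (π.splitInterval B p hB hp) π ↔ ∀ t ∈ B, t ≤ p.2 := by
  have hends := mem_intervalEnds.1 hp
  obtain ⟨z, hz, hza⟩ := hends.2.2
  have hne := blockInterval_nonempty hp
  have hss := blockInterval_ssubset hp
  have hzC : z ∈ B \ blockInterval B p.1 p.2 :=
    Finset.mem_sdiff.2 ⟨hz, fun h => (mem_blockInterval.1 h).2.1.not_gt hza⟩
  constructor
  · rintro ⟨B', hB', Q, -, hQ, hparts⟩
    have hBB : B = B' := by
      by_contra hne'
      apply Finpartition.notMem_splitBlock π.1 hB hne hss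
      change B ∈ (π.splitInterval B p hB hp).1.parts
      rw [hparts]
      exact Finset.mem_union_left _ (Finset.mem_erase.2 ⟨hne', hB⟩)
    subst hBB
    have hmem : B \ blockInterval B p.1 p.2 ∈ (π.splitInterval B p hB hp).1.parts :=
      (NC.mem_splitInterval hB hp).2 (Or.inr (Or.inr rfl))
    rw [hparts, Finset.mem_union] at hmem
    rcases hmem with hmem | hmem
    · exact absurd (Finset.mem_of_mem_erase hmem) (Finpartition.sdiff_notMem_parts π.1 hB hne hss)
    · obtain ⟨c, -, d, -, hcd⟩ := hQ _ hmem
      intro t ht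
      by_contra htb
      rw [not_le] at htb
      have htC : t ∈ B \ blockInterval B p.1 p.2 :=
        Finset.mem_sdiff.2 ⟨ht, fun h => (mem_blockInterval.1 h).2.2.not_gt htb⟩
      have hpC : p.1 ∈ B \ blockInterval B p.1 p.2 := by
        rw [hcd, Finset.mem_filter] at hzC htC ⊢
        exact ⟨hends.1.1, hzC.2.1.trans hza.le, (hends.2.1.trans htb.le).trans htC.2.2⟩
      exact (Finset.mem_sdiff.1 hpC).2 (mem_blockInterval.2 ⟨hends.1.1, le_rfl, hends.2.1⟩)
  · intro hmax
    have hBne : B ≠ ⊥ := π.1.ne_bot hB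
    have hBmem : B ∈ (Finpartition.indiscrete hBne).parts := by simp
    refine ⟨B, hB,
      (Finpartition.indiscrete hBne).splitBlock B (blockInterval B p.1 p.2) hBmem hne hss, ?_, ?_, ?_⟩
    · have hpair : (({B} : Finset (Finset (Fin n))).erase B ∪
          {blockInterval B p.1 p.2, B \ blockInterval B p.1 p.2}).card = 2 := by
        rw [Finset.erase_singleton, Finset.empty_union]
        exact Finset.card_pair (blockInterval_ne_sdiff hp hp)
      exact hpair.ge
    · intro D hD
      rw [Finpartition.mem_splitBlock] at hD
      rcases hD with hD | hD | hD
      · simp at hD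
      · exact ⟨p.1, hends.1.1, p.2, hends.1.2, hD⟩
      · have hlow : ({t ∈ B | t < p.1}).Nonempty := ⟨z, Finset.mem_filter.2 ⟨hz, hza⟩⟩
        have hBn : B.Nonempty := ⟨z, hz⟩
        have h1 := Finset.max'_mem _ hlow
        rw [Finset.mem_filter] at h1
        refine ⟨B.min' hBn, B.min'_mem hBn, _, h1.1, ?_⟩
        rw [hD]
        ext t
        rw [Finset.mem_sdiff, mem_blockInterval, Finset.mem_filter]
        constructor
        · rintro ⟨ht, htn⟩
          refine ⟨ht, B.min'_le t ht, Finset.le_max' _ _ (Finset.mem_filter.2 ⟨ht, ?_⟩)⟩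
          by_contra hle
          exact htn ⟨ht, not_lt.1 hle, hmax t ht⟩
        · rintro ⟨ht, -, htm⟩
          exact ⟨ht, fun h => (htm.trans_lt h1.2).not_ge h.2.1⟩
    · change π.1.parts.erase B ∪ _ = π.1.parts.erase B ∪ (({B} : Finset _).erase B ∪ _)
      rw [Finset.erase_singleton, Finset.empty_union]

open Classical in
/-- A sum over the elements covered by `π` is a sum over the blocks of `π` and the intervals of
these blocks that can be split off. -/
theorem NC.sum_covBy {R : Type*} [CommRing R] (π : NC n) (x : R) (y : ℕ → R) :
    ∑ ρ with ρ ⋖ π, (if IntervalSplit ρ π then 1 else x) * ∏ D ∈ ρ.1.parts, y D.card =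
      ∑ B ∈ π.1.parts, (∏ D ∈ π.1.parts.erase B, y D.card) *
        ∑ p ∈ intervalEnds B, (if ∀ t ∈ B, t ≤ p.2 then 1 else x) *
          (y (blockInterval B p.1 p.2).card * y (B.card - (blockInterval B p.1 p.2).card)) := by
  simp_rw [Finset.mul_sum]
  rw [Finset.sum_sigma']
  symm
  refine Finset.sum_bij (fun q hq => π.splitInterval q.1 q.2 (Finset.mem_sigma.1 hq).1
    (Finset.mem_sigma.1 hq).2) ?_ ?_ ?_ ?_
  · intro q hq
    exact Finset.mem_filter.2 ⟨Finset.mem_univ _, π.splitInterval_covBy ..⟩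
  · rintro ⟨B, p⟩ hq ⟨B', p'⟩ hq' h
    obtain ⟨h1, h2⟩ := NC.splitInterval_inj h
    dsimp only at h1 h2
    rw [h1, h2]
  · intro ρ hρ
    obtain ⟨B, p, hB, hp, h⟩ := NC.exists_eq_splitInterval (Finset.mem_filter.1 hρ).2
    exact ⟨⟨B, p⟩, Finset.mem_sigma.2 ⟨hB, hp⟩, h⟩
  · rintro ⟨B, p⟩ hq
    obtain ⟨hB, hp⟩ := Finset.mem_sigma.1 hq
    dsimp only at hB hp ⊢
    simp only [intervalSplit_splitInterval_iff hB hp]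
    have := π.1.prod_splitBlock hB (blockInterval_nonempty hp) (blockInterval_ssubset hp)
      (fun D => y D.card)
    simp only [NC.splitInterval]
    rw [this, Finset.card_sdiff_of_subset (blockInterval_ssubset hp).1]
    ring

end Covers

/-! ### Generating functions for splitting one block. -/

section BlockSums

variable {α : Type*} [LinearOrder α] {R : Type*} [CommRing R]

/-- Number `B` increasingly from 0: `c` is the size of the interval and `i` the position of its
first element, with `i ≥ 1` because the minimum is avoided. -/
theorem sum_intervalEnds_eq_sum_range (B : Finset α) (x : R) (F : ℕ → R) :
    ∑ p ∈ intervalEnds B, (if ∀ t ∈ B, t ≤ p.2 then 1 else x) * F (blockInterval B p.1 p.2).card =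
      ∑ c ∈ Finset.Ico 1 B.card, ∑ i ∈ Finset.Ico 1 (B.card + 1 - c),
        (if i + c = B.card then 1 else x) * F c := by
  set m := B.card with hm
  let e : Fin m ↪o α := B.orderEmbOfFin rfl
  have he : ∀ i, e i ∈ B := fun i => B.orderEmbOfFin_mem rfl i
  have hsurj : ∀ t ∈ B, ∃ i, e i = t := by
    intro t ht
    have : t ∈ Set.range e := by
      rw [Finset.range_orderEmbOfFin]
      exact ht
    exact this
  rw [Finset.sum_sigma']
  symm
  refine Finset.sum_bij (fun q hq => (e ⟨q.2, ?_⟩, e ⟨q.2 + q.1 - 1, ?_⟩)) ?_ ?_ ?_ ?_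
  · simp only [Finset.mem_sigma, Finset.mem_Ico] at hq
    omega
  · simp only [Finset.mem_sigma, Finset.mem_Ico] at hq
    omega
  · rintro ⟨c, i⟩ hq
    simp only [Finset.mem_sigma, Finset.mem_Ico] at hq
    rw [mem_intervalEnds]
    refine ⟨⟨he _, he _⟩, e.monotone ?_, e ⟨0, by omega⟩, he _, e.strictMono ?_⟩
    · rw [Fin.mk_le_mk]
      dsimp only
      omega
    · rw [Fin.mk_lt_mk]
      exact hq.2.1
  · rintro ⟨c, i⟩ hq ⟨c', i'⟩ hq' h
    simp only [Finset.mem_sigma, Finset.mem_Ico] at hq hq'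
    simp only [Prod.mk.injEq, EmbeddingLike.apply_eq_iff_eq, Fin.mk.injEq] at h
    obtain ⟨h1, h2⟩ := h
    obtain rfl : c = c' := by omega
    rw [h1]
  · rintro ⟨a, b⟩ hp
    rw [mem_intervalEnds] at hp
    obtain ⟨⟨haB, hbB⟩, hab, z, hz, hza⟩ := hp
    obtain ⟨i, rfl⟩ := hsurj a haB
    obtain ⟨j, rfl⟩ := hsurj b hbB
    obtain ⟨l, rfl⟩ := hsurj z hz
    have hij : (i : ℕ) ≤ j := e.le_iff_le.1 hab
    have hli : (l : ℕ) < i := e.lt_iff_lt.1 hza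
    refine ⟨⟨j + 1 - i, i⟩, ?_, ?_⟩
    · simp only [Finset.mem_sigma, Finset.mem_Ico]
      omega
    · refine Prod.ext rfl (congrArg e (Fin.ext ?_))
      change (i : ℕ) + (j + 1 - i) - 1 = j
      omega
  · rintro ⟨c, i⟩ hq
    simp only [Finset.mem_sigma, Finset.mem_Ico] at hq
    dsimp only
    congr 1
    · refine if_congr ?_ rfl rfl
      constructor
      · intro hic t ht
        obtain ⟨j, rfl⟩ := hsurj t ht
        apply e.monotone
        rw [Fin.le_def]
        dsimp only
        omega
      · intro h
        have := e.le_iff_le.1 (h (e ⟨m - 1, by omega⟩) (he _))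
        rw [Fin.mk_le_mk] at this
        omega
    · congr 1
      have hseg : blockInterval B (e ⟨i, by omega⟩) (e ⟨i + c - 1, by omega⟩) =
          (Finset.Icc (⟨i, by omega⟩ : Fin m) ⟨i + c - 1, by omega⟩).map e.toEmbedding := by
        ext t
        rw [mem_blockInterval, Finset.mem_map]
        constructor
        · rintro ⟨htB, h1, h2⟩
          obtain ⟨j, rfl⟩ := hsurj t htB
          exact ⟨j, Finset.mem_Icc.2 ⟨e.le_iff_le.1 h1, e.le_iff_le.1 h2⟩, rfl⟩
        · rintro ⟨j, hj, rfl⟩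
          rw [Finset.mem_Icc] at hj
          exact ⟨he j, e.monotone hj.1, e.monotone hj.2⟩
      rw [hseg, Finset.card_map, Fin.card_Icc]
      dsimp only
      omega

theorem sum_Ico_ite_last {m c : ℕ} (hcm : c < m) (x : R) :
    ∑ i ∈ Finset.Ico 1 (m + 1 - c), (if i + c = m then 1 else x) =
      1 - x + x * ((m - c : ℕ) : R) := by
  obtain ⟨d, rfl⟩ : ∃ d, m = c + (d + 1) := ⟨m - c - 1, by omega⟩
  rw [show c + (d + 1) + 1 - c = d + 1 + 1 by omega, show c + (d + 1) - c = d + 1 by omega,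
    Finset.sum_Ico_succ_top (by omega), if_pos (by omega)]
  rw [Finset.sum_congr rfl (g := fun _ => x), Finset.sum_const, Nat.card_Ico]
  · simp
    ring
  · intro i hi
    rw [Finset.mem_Ico] at hi
    rw [if_neg (by omega)]

open PowerSeries in
/-- The generating function of the block weights `y`. -/
noncomputable def blockSeries (y : ℕ → R) : R⟦X⟧ := PowerSeries.mk fun m => if m = 0 then 0 else y m

theorem coeff_X_mul_derivative (f : PowerSeries R) (m : ℕ) :
    PowerSeries.coeff m (PowerSeries.X * PowerSeries.derivative R f) =
      m * PowerSeries.coeff m f := by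
  cases m with
  | zero => simp
  | succ m =>
    rw [PowerSeries.coeff_succ_X_mul, PowerSeries.coeff_derivative]
    push_cast
    ring

/-- The generating function of the total weights of the ways to split a block into two. -/
noncomputable def splitSeries (x : R) (y : ℕ → R) : PowerSeries R :=
  blockSeries y * (PowerSeries.C (1 - x) * blockSeries y +
    PowerSeries.C x * (PowerSeries.X * PowerSeries.derivative R (blockSeries y)))

theorem sum_intervalEnds (B : Finset α) (x : R) (y : ℕ → R) :
    ∑ p ∈ intervalEnds B, (if ∀ t ∈ B, t ≤ p.2 then 1 else x) *
        (y (blockInterval B p.1 p.2).card * y (B.card - (blockInterval B p.1 p.2).card)) =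
      PowerSeries.coeff B.card (splitSeries x y) := by
  rw [sum_intervalEnds_eq_sum_range B x (fun c => y c * y (B.card - c))]
  rw [splitSeries, PowerSeries.coeff_mul, Finset.Nat.sum_antidiagonal_eq_sum_range_succ_mk]
  have hsub : Finset.Ico 1 B.card ⊆ Finset.range B.card.succ := by
    intro c hc
    rw [Finset.mem_Ico] at hc
    exact Finset.mem_range.2 (by omega)
  rw [← Finset.sum_subset hsub]
  · refine Finset.sum_congr rfl fun c hc => ?_
    rw [Finset.mem_Ico] at hc
    rw [← Finset.sum_mul, sum_Ico_ite_last hc.2]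
    simp only [map_add, PowerSeries.coeff_C_mul, coeff_X_mul_derivative]
    simp only [blockSeries, PowerSeries.coeff_mk]
    rw [if_neg (by omega), if_neg (by omega)]
    ring
  · intro c hc hc'
    rw [Finset.mem_range] at hc
    rw [Finset.mem_Ico] at hc'
    simp only [map_add, PowerSeries.coeff_C_mul, coeff_X_mul_derivative]
    simp only [blockSeries, PowerSeries.coeff_mk]
    -- The end terms vanish because `blockSeries y` has constant coefficient 0.
    rcases (by omega : c = 0 ∨ B.card - c = 0) with h | h <;> simp [h]

/-- The operator `X d/dX` multiplies the coefficient at `n` by `n`, and applied to the power `k + 2`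
it yields the derivative term of `splitSeries`. -/
theorem coeff_pow_mul_splitSeries (n k : ℕ) (x : R) (y : ℕ → R) :
    ((k + 2 : ℕ) : R) * PowerSeries.coeff n (blockSeries y ^ k * splitSeries x y) =
      ((k + 2 : ℕ) * (1 - x) + x * n) * PowerSeries.coeff n (blockSeries y ^ (k + 2)) := by
  have h : ((k + 2 : ℕ) : PowerSeries R) * (blockSeries y ^ k * splitSeries x y) =
      PowerSeries.C (((k + 2 : ℕ) : R) * (1 - x)) * blockSeries y ^ (k + 2) +
      PowerSeries.C x * (PowerSeries.X * PowerSeries.derivative R (blockSeries y ^ (k + 2))) := by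
    rw [PowerSeries.derivative_pow, splitSeries, map_mul, map_natCast]
    simp only [show k + 2 - 1 = k + 1 by omega]
    ring
  have h' := congrArg (PowerSeries.coeff n) h
  rw [← map_natCast (PowerSeries.C (R := R)), PowerSeries.coeff_C_mul, map_add,
    PowerSeries.coeff_C_mul, PowerSeries.coeff_C_mul, coeff_X_mul_derivative] at h'
  rw [h']
  ring

open Classical in
theorem NC.sum_covBy_eq_coeff {n : ℕ} (π : NC n) (x : R) (y : ℕ → R) :
    ∑ ρ with ρ ⋖ π, (if IntervalSplit ρ π then 1 else x) * ∏ D ∈ ρ.1.parts, y D.card =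
      ∑ B ∈ π.1.parts, (∏ D ∈ π.1.parts.erase B, y D.card) *
        PowerSeries.coeff B.card (splitSeries x y) := by
  rw [NC.sum_covBy]
  refine Finset.sum_congr rfl fun B _ => ?_
  rw [← sum_intervalEnds]
  congr!

end BlockSums

/-! ### Recursion on the length of a chain, and first-order perturbation. -/

section Chains

variable {n k : ℕ} {R : Type*} [CommRing R]

open Classical in
/-- The weight of a final chain, with values `x i` in place of the indeterminates. -/
noncomputable def FinalChain.weightAt (x : ℕ → R) (c : FinalChain n k) : R :=
  ∏ j : Fin (k - 1),
    if IntervalSplit (c.1 ⟨j, by omega⟩) (c.1 ⟨j + 1, by omega⟩) then 1 else x (n - k + j)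

/-- Extending a final chain at its lower end. -/
def FinalChain.cons (c : FinalChain n (k + 1)) (ρ : NC n) (hρ : ρ ⋖ c.1 0) :
    FinalChain n (k + 2) :=
  ⟨Fin.cons ρ c.1, by
    refine ⟨fun j => ?_, fun j hj => ?_⟩
    · obtain ⟨j, hj⟩ := j
      cases j with
      | zero => exact hρ
      | succ j => exact c.2.1 ⟨j, by omega⟩
    · cases j using Fin.cases with
      | zero => simp at hj
      | succ j => exact c.2.2 j (by simpa using hj)⟩

/-- Removing the lower end of a final chain. -/
def FinalChain.tail (c : FinalChain n (k + 2)) : FinalChain n (k + 1) :=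
  ⟨Fin.tail c.1, fun j => c.2.1 ⟨j + 1, by omega⟩, fun j hj => c.2.2 j.succ (by simpa using hj)⟩

open Classical in
theorem FinalChain.weightAt_cons (hk : k + 2 ≤ n) (x : ℕ → R) (c : FinalChain n (k + 1)) (ρ : NC n)
    (hρ : ρ ⋖ c.1 0) : (c.cons ρ hρ).weightAt x =
      (if IntervalSplit ρ (c.1 0) then 1 else x (n - (k + 2))) * c.weightAt x := by
  unfold FinalChain.weightAt
  refine (Fin.prod_univ_succ (n := k) _).trans ?_
  refine congrArg₂ (· * ·) rfl (Finset.prod_congr rfl fun j _ => ?_)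
  -- The index shift needs `k + 2 ≤ n`, which keeps the subtraction from truncating.
  have hj : n - (k + 2) + (j.succ : ℕ) = n - (k + 1) + j := by
    rw [Fin.val_succ]
    omega
  rw [hj]
  rfl

open Classical in
theorem FinalChain.sum_weightAt_mul (hk : k + 2 ≤ n) (x : ℕ → R) (Φ : NC n → R) :
    ∑ c : FinalChain n (k + 2), c.weightAt x * Φ (c.1 0) =
      ∑ c : FinalChain n (k + 1), c.weightAt x *
        ∑ ρ with ρ ⋖ c.1 0, (if IntervalSplit ρ (c.1 0) then 1 else x (n - (k + 2))) * Φ ρ := by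
  simp_rw [Finset.mul_sum]
  rw [Finset.sum_sigma']
  symm
  refine Finset.sum_bij' (fun q hq => q.1.cons q.2 (by simpa using hq))
    (fun c _ => ⟨c.tail, c.1 0⟩) ?_ ?_ ?_ ?_ ?_
  · intros
    exact Finset.mem_univ _
  · intro c _
    simp only [Finset.mem_sigma, Finset.mem_univ, Finset.mem_filter, true_and]
    exact c.2.1 ⟨0, by omega⟩
  · intro q hq
    rfl
  · intro c _
    exact Subtype.ext (Fin.cons_self_tail c.1)
  · rintro ⟨c, ρ⟩ hq
    dsimp only
    rw [FinalChain.weightAt_cons hk]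
    change _ = _ * Φ ρ
    ring

theorem parts_top_univ (hn : 1 ≤ n) :
    (⊤ : Finpartition (Finset.univ : Finset (Fin n))).parts = {Finset.univ} := by
  have hne : (Finset.univ : Finset (Fin n)) ≠ ⊥ := by
    have : Nonempty (Fin n) := ⟨⟨0, hn⟩⟩
    exact Finset.univ_nonempty.ne_empty
  have h := Finpartition.parts_top_subset (Finset.univ : Finset (Fin n))
  rcases Finset.subset_singleton_iff.1 h with h | h
  · exact absurd (Finpartition.parts_eq_empty_iff.1 h) hne
  · exact h

theorem isNoncrossing_top (hn : 1 ≤ n) :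
    IsNoncrossing (⊤ : Finpartition (Finset.univ : Finset (Fin n))) := by
  rw [isNoncrossing_iff, parts_top_univ hn]
  intro i j k l _ _ _ B hB C hC _ _ _ _
  rw [Finset.mem_singleton.1 hB, Finset.mem_singleton.1 hC]

theorem FinalChain.sum_length_one (hn : 1 ≤ n) (x : ℕ → R) (y : ℕ → R) :
    ∑ c : FinalChain n 1, c.weightAt x * ∏ B ∈ (c.1 0).1.parts, y B.card = y n := by
  let c₀ : FinalChain n 1 :=
    ⟨fun _ => ⟨⊤, isNoncrossing_top hn⟩, fun j => j.elim0, fun _ _ => rfl⟩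
  rw [Fintype.sum_eq_single c₀]
  · change (∏ j : Fin 0, _) *
      ∏ B ∈ (⊤ : Finpartition (Finset.univ : Finset (Fin n))).parts, y B.card = y n
    rw [parts_top_univ hn]
    simp
  · intro c hc
    exfalso
    apply hc
    apply Subtype.ext
    funext j
    exact Subtype.ext (c.2.2 j (by omega))

open Polynomial in
theorem eval_zero_derivative_prod_blocks {ι : Type*} [DecidableEq ι] (s : Finset ι) (u v : ι → R) :
    (derivative (∏ i ∈ s, (C (u i) + X * C (v i)))).eval 0 =
      ∑ i ∈ s, (∏ j ∈ s.erase i, u j) * v i := by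
  rw [derivative_prod_finset, eval_finsetSum]
  refine Finset.sum_congr rfl fun i _ => ?_
  simp [eval_prod]

open Polynomial in
/-- Perturbing the block weights to first order. -/
theorem eval_zero_derivative_coeff_blockSeries_pow (n k : ℕ) (y g : ℕ → R) (hg : g 0 = 0) :
    (derivative (PowerSeries.coeff n
      (blockSeries (fun m => (C (y m) + X * C (g m) : R[X])) ^ (k + 1)))).eval 0 =
      (k + 1 : ℕ) * PowerSeries.coeff n (blockSeries y ^ k * PowerSeries.mk g) := by
  have hsplit : blockSeries (fun m => (C (y m) + X * C (g m) : R[X])) =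
      PowerSeries.map C (blockSeries y) +
        PowerSeries.C X * PowerSeries.map C (PowerSeries.mk g) := by
    ext1 m
    simp only [blockSeries, PowerSeries.coeff_mk, map_add, PowerSeries.coeff_map,
      PowerSeries.coeff_C_mul]
    split_ifs with h
    -- `blockSeries` drops index 0 while `PowerSeries.mk g` keeps it; they agree because `g 0 = 0`.
    · simp [h, hg]
    · rfl
  -- `K` collects the terms divisible by `X ^ 2`, which do not affect the derivative at 0.
  obtain ⟨K, hK⟩ := powAddExpansion (PowerSeries.map C (blockSeries y))
    (PowerSeries.C X * PowerSeries.map C (PowerSeries.mk g)) (k + 1)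
  have hexp : blockSeries (fun m => (C (y m) + X * C (g m) : R[X])) ^ (k + 1) =
      PowerSeries.map C (blockSeries y ^ (k + 1)) +
      PowerSeries.C X * PowerSeries.map C (((k + 1 : ℕ) : PowerSeries R) *
        (blockSeries y ^ k * PowerSeries.mk g)) +
      PowerSeries.C (X ^ 2) * (K * PowerSeries.map C (PowerSeries.mk g) ^ 2) := by
    rw [hsplit, hK]
    simp only [map_mul, map_pow, map_natCast, Nat.add_sub_cancel]
    ring
  rw [hexp]
  simp only [map_add, PowerSeries.coeff_map, PowerSeries.coeff_C_mul, derivative_mul,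
    derivative_C, derivative_X, derivative_X_pow]
  rw [← map_natCast (PowerSeries.C (R := R)), PowerSeries.coeff_C_mul]
  simp

end Chains

/-! ### The closed formula and its specialisations. -/

/-- The generating function of final chains, where the bottom element `π` is weighted by a product
of weights of the block sizes of `π`. -/
theorem FinalChain.sum_weightAt_mul_prod {n : ℕ} (k : ℕ) (hk : k + 1 ≤ n) :
    ∀ {R : Type} [CommRing R] [IsDomain R] [CharZero R] (x y : ℕ → R),
    ((k + 1 : ℕ) : R) * ∑ c : FinalChain n (k + 1), c.weightAt x *
        ∏ B ∈ (c.1 0).1.parts, y B.card =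
      (∏ i ∈ Finset.Ico (n - (k + 1)) (n - 1), ((i : R) * x i + ((n - i : ℕ) : R))) *
        PowerSeries.coeff n (blockSeries y ^ (k + 1)) := by
  induction k with
  | zero =>
    intro R _ _ _ x y
    have hn : n ≠ 0 := by omega
    rw [FinalChain.sum_length_one (by omega)]
    simp [blockSeries, hn]
  | succ k ih =>
    intro R _ _ _ x y
    -- The polynomial variable is the perturbation parameter; `R` is quantified inside the induction
    -- to allow this change of ring.
    have hIH := ih (by omega) (R := Polynomial R) (fun i => Polynomial.C (x i))
      (fun m => Polynomial.C (y m) +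
        Polynomial.X * Polynomial.C (PowerSeries.coeff m (splitSeries (x (n - (k + 2))) y)))
    set x₀ := x (n - (k + 2)) with hx₀
    have hweight : ∀ c : FinalChain n (k + 1),
        c.weightAt (fun i => Polynomial.C (x i)) = Polynomial.C (c.weightAt x) := by
      intro c
      unfold FinalChain.weightAt
      rw [map_prod]
      refine Finset.prod_congr rfl fun j _ => ?_
      split_ifs <;> simp
    have hprod : ∏ i ∈ Finset.Ico (n - (k + 1)) (n - 1), ((i : Polynomial R) * Polynomial.C (x i) +
        ((n - i : ℕ) : Polynomial R)) = Polynomial.C (∏ i ∈ Finset.Ico (n - (k + 1)) (n - 1),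
          ((i : R) * x i + ((n - i : ℕ) : R))) := by
      rw [map_prod]
      exact Finset.prod_congr rfl fun i _ => by simp
    have hg0 : PowerSeries.coeff 0 (splitSeries x₀ y) = 0 := by
      simp [splitSeries, blockSeries]
    -- By the product rule the derivative at 0 replaces one block factor at a time, which matches
    -- the sum over covers.
    have hder := congrArg (fun p => (Polynomial.derivative p).eval 0) hIH
    simp only [hweight, hprod] at hder
    rw [← map_natCast (Polynomial.C (R := R)), Polynomial.derivative_C_mul,
      Polynomial.derivative_C_mul, Polynomial.eval_C_mul, Polynomial.eval_C_mul,
      eval_zero_derivative_coeff_blockSeries_pow n k y _ hg0, Polynomial.derivative_sum,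
      Polynomial.eval_finsetSum] at hder
    simp only [Polynomial.derivative_C_mul, Polynomial.eval_C_mul,
      eval_zero_derivative_prod_blocks] at hder
    have hk0 : ((k + 1 : ℕ) : R) ≠ 0 := Nat.cast_ne_zero.2 (by omega)
    have hmk : PowerSeries.mk (fun m => PowerSeries.coeff m (splitSeries x₀ y)) =
        splitSeries x₀ y := by
      ext1 m
      simp
    rw [hmk, mul_left_comm] at hder
    have hsum := mul_left_cancel₀ hk0 hder
    classical
    rw [FinalChain.sum_weightAt_mul (k := k) hk x (fun ρ => ∏ B ∈ ρ.1.parts, y B.card)]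
    simp_rw [NC.sum_covBy_eq_coeff, ← hx₀]
    rw [hsum, mul_left_comm, coeff_pow_mul_splitSeries, 
      Finset.prod_eq_prod_Ico_succ_bot (show n - (k + 1 + 1) < n - 1 by omega),
      show n - (k + 1 + 1) + 1 = n - (k + 1) by omega,
      show n - (n - (k + 1 + 1)) = k + 2 by omega]
    -- The factors agree: `(k + 2)(1 - x₀) + n x₀ = (n - (k + 2)) x₀ + (k + 2)`.
    change _ = ((n - (k + 2) : ℕ) * x₀ + _) * _ * _
    rw [Nat.cast_sub hk]
    ring

/-- With unit weights the series is `X / (1 - X)`. -/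
theorem coeff_blockSeries_one_pow {R : Type*} [CommRing R] (n k : ℕ) (hk : k + 1 ≤ n) :
    PowerSeries.coeff n (blockSeries (fun _ => (1 : R)) ^ (k + 1)) = ((n - 1).choose k : R) := by
  have h : blockSeries (fun _ => (1 : R)) = PowerSeries.X * PowerSeries.mk 1 := by
    ext1 m
    cases m <;> simp [blockSeries, PowerSeries.coeff_succ_X_mul]
  obtain ⟨m, rfl⟩ : ∃ m, n = m + (k + 1) := ⟨n - (k + 1), by omega⟩
  rw [h, mul_pow, mul_comm, PowerSeries.coeff_mul_X_pow, PowerSeries.mk_one_pow_eq_mk_choose_add,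
    PowerSeries.coeff_mk, show m + (k + 1) - 1 = k + m by omega]

theorem FinalChain.sum_weightAt {n k : ℕ} (hk : 1 ≤ k) (hkn : k ≤ n) {R : Type} [CommRing R]
    [IsDomain R] [CharZero R] (x : ℕ → R) :
    (n : R) * ∑ c : FinalChain n k, c.weightAt x =
      (∏ i ∈ Finset.Ico (n - k) (n - 1), ((i : R) * x i + ((n - i : ℕ) : R))) *
        (n.choose k : R) := by
  obtain ⟨k, rfl⟩ : ∃ l, k = l + 1 := ⟨k - 1, by omega⟩
  have h := FinalChain.sum_weightAt_mul_prod k hkn x (fun _ => 1)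
  simp only [Finset.prod_const_one, mul_one] at h
  rw [coeff_blockSeries_one_pow n k hkn] at h
  have hk0 : ((k + 1 : ℕ) : R) ≠ 0 := Nat.cast_ne_zero.2 (by omega)
  apply mul_left_cancel₀ hk0
  rw [mul_left_comm, h]
  have hch : (n : R) * ((n - 1).choose k : R) = (n.choose (k + 1) : R) * ((k + 1 : ℕ) : R) := by
    obtain ⟨m, rfl⟩ : ∃ m, n = m + 1 := ⟨n - 1, by omega⟩
    exact_mod_cast Nat.add_one_mul_choose_eq m k
  linear_combination (∏ i ∈ Finset.Ico (n - (k + 1)) (n - 1),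
    ((i : R) * x i + ((n - i : ℕ) : R))) * hch

theorem mainTheorem3 (n k : ℕ) (hk : 1 ≤ k) (hkn : k ≤ n) :
    (∑ c : FinalChain n k, c.weight =
      MvPolynomial.C ((1 / n : ℚ) * (n.choose k : ℚ)) *
        ∏ i ∈ Finset.Ico (n - k) (n - 1),
          ((i : MvPolynomial ℕ ℚ) * MvPolynomial.X i + ((n - i : ℕ) : MvPolynomial ℕ ℚ))) ∧
    (Fintype.card (FinalChain n k) : ℚ) = (n : ℚ) ^ ((k : ℤ) - 2) * (n.choose k : ℚ) := by
  have hn : (n : ℚ) ≠ 0 := Nat.cast_ne_zero.2 (by omega)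
  constructor
  · have h := FinalChain.sum_weightAt hk hkn (R := MvPolynomial ℕ ℚ) MvPolynomial.X
    have hn' : (n : MvPolynomial ℕ ℚ) ≠ 0 := Nat.cast_ne_zero.2 (by omega)
    apply mul_left_cancel₀ hn'
    -- `FinalChain.weight` is definitionally `FinalChain.weightAt` at `MvPolynomial.X`.
    refine h.trans ?_
    rw [← mul_assoc, ← map_natCast (MvPolynomial.C (R := ℚ) (σ := ℕ)) n, ← map_mul,
      ← map_natCast (MvPolynomial.C (R := ℚ) (σ := ℕ)) (n.choose k),
      show (n : ℚ) * (1 / n * (n.choose k : ℚ)) = n.choose k by field_simp]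
    ring
  · have h := FinalChain.sum_weightAt hk hkn (R := ℚ) (fun _ => 1)
    have hw : ∀ c : FinalChain n k, c.weightAt (fun _ => (1 : ℚ)) = 1 := by
      intro c
      simp [FinalChain.weightAt]
    have hp : ∏ i ∈ Finset.Ico (n - k) (n - 1), ((i : ℚ) * 1 + ((n - i : ℕ) : ℚ)) =
        (n : ℚ) ^ (k - 1) := by
      rw [Finset.prod_congr rfl (g := fun _ => (n : ℚ)), Finset.prod_const, Nat.card_Ico,
        show n - 1 - (n - k) = k - 1 by omega]
      intro i hi
      rw [Finset.mem_Ico] at hi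
      rw [Nat.cast_sub (by omega)]
      ring
    rw [hp] at h
    simp only [hw, Finset.sum_const, Finset.card_univ, nsmul_eq_mul, mul_one] at h
    apply mul_left_cancel₀ hn
    -- The exponent `k - 2` is `-1` when `k = 1`, hence the integer power.
    rw [h, ← mul_assoc, ← zpow_one_add₀ hn, ← zpow_natCast]
    congr 2
    omega
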